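/- \textbf{Corollary (Currents with support disjoint from a spike).} Let $S$ be a compact connected oriented surface, possibly with boundary, with $\chi(S)<0$, endowed with a hyperbolic metric $h$ (curvature $-1$, geodesic boundary). Identify its universal cover $\tilde S$, with the lifted metric, with a closed convex subset of the hyperbolic plane bounded by complete geodesics. Let $\partial_\infty\tilde S$ be the set of points of the circle at infinity that lie in the closure of $\tilde S$, with the cyclic order inherited from that circle, where $a\prec b\prec d$ means that $a,b,d$ are distinct and the path on the circle from $a$ to $d$ in the positive direction meets $b$. For $y_1,y_2\in\partial_\infty\tilde S$ let $[y_1,y_2]_\infty$ consist of $y_1$, $y_2$ and all $y\in\partial_\infty\tilde S$ with $y_1\prec y\prec y_2$, and let $(y_1,y_2)_\infty=[y_1,y_2]_\infty\setminus\{y_1,y_2\}$. Let $\mathcal G(\tilde S)$ be the space of unordered pairs of distinct points of $\partial_\infty\tilde S$ (bi-infinite geodesics of $\tilde S$), and call $\{x_1,x_2\},\{x_1',x_2'\}\in\mathcal G(\tilde S)$ transverse if, after relabelling the points within each pair, $x_1\prec x_1'\prec x_2$ and $x_2\prec x_2'\prec x_1$. The projections to $S$ of two geodesics of $\tilde S$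 cross transversely if some of their $\pi_1(S)$-translates are transverse. A geodesic current on $S$ is a locally finite, $\pi_1(S)$-invariant Borel measure on $\mathcal G(\tilde S)$. Let $x,y_1,y_2\in\partial_\infty\tilde S$ with $x\notin[y_1,y_2]_\infty$. Suppose that, for every $y\in[y_1,y_2]_\infty$, the geodesic $\eta_y$ of $S$ determined by $\{x,y\}\in\mathcal G(\tilde S)$ is not closed. Let $c$ be a geodesic current on $S$ such that no geodesic in the support of $c$ crosses $\eta_{y_1}$ or $\eta_{y_2}$ transversely. Then the set $\{x\}\times(y_1,y_2)_\infty=\{\{x,y\} : y\in(y_1,y_2)_\infty\}\subset\mathcal G(\tilde S)$ is disjoint from the support of $c$. -/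

import Mathlib

open UpperHalfPlane Filter Topology MeasureTheory Bornology
open scoped MatrixGroups

noncomputable section

/-! ## The hyperbolic plane, its boundary circle and its geodesics

The hyperbolic plane is the upper half-plane `ℍ`, its circle at infinity is `OnePoint ℝ`, and
`SL(2, ℝ)` acts on both by Moebius transformations. -/

namespace Hyp

/-- `SL(2, ℝ)` acts on the circle at infinity by Moebius transformations. -/
instance : MulAction SL(2, ℝ) (OnePoint ℝ) :=
  MulAction.compHom (OnePoint ℝ) (Matrix.SpecialLinearGroup.mapGL ℝ : SL(2, ℝ) →* GL (Fin 2) ℝ)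

/-- A point of the hyperbolic plane, as a point of the Riemann sphere. -/
def planeToSphere (z : ℍ) : OnePoint ℂ := ((z : ℂ) : OnePoint ℂ)

/-- A point of the circle at infinity, as a point of the Riemann sphere. -/
def circleToSphere (ξ : OnePoint ℝ) : OnePoint ℂ := ξ.map (algebraMap ℝ ℂ)

/-- The points of the circle at infinity that lie in the closure of `K`; the closure is taken in
the closed hyperbolic disc `ℍ ∪ OnePoint ℝ`, realised inside the Riemann sphere. -/
def idealBoundary (K : Set ℍ) : Set (OnePoint ℝ) :=
  {ξ | circleToSphere ξ ∈ closure (planeToSphere '' K)}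

/-- The circle at infinity cut open at `∞`. -/
def cutCircle (ξ : OnePoint ℝ) : WithTop ℝ := ξ.elim ⊤ (fun t : ℝ => (t : WithTop ℝ))

/-- `Prec x z y` is `x ≺ z ≺ y`: the three points are distinct and a path on the circle at
infinity travelling from `x` to `y` in the positive direction meets `z`. -/
def Prec (x z y : OnePoint ℝ) : Prop :=
  (cutCircle x < cutCircle z ∧ cutCircle z < cutCircle y) ∨
  (cutCircle z < cutCircle y ∧ cutCircle y < cutCircle x) ∨
  (cutCircle y < cutCircle x ∧ cutCircle x < cutCircle z)

/-- `K` contains the geodesic segment between any two of its points. -/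
def GeodesicallyConvex (K : Set ℍ) : Prop :=
  ∀ z ∈ K, ∀ w ∈ K, ∀ u : ℍ, dist z u + dist u w = dist z w → u ∈ K

/-- Every frontier point of `K` lies on a complete geodesic contained in the frontier, that is,
the frontier of `K` is a union of complete geodesics. -/
def GeodesicFrontier (K : Set ℍ) : Prop :=
  ∀ z ∈ frontier K, ∃ η : ℝ → ℍ, Isometry η ∧ η 0 = z ∧ ∀ t, η t ∈ frontier K

theorem affine_tendsto_cobounded {u v : ℂ} (hu : u ≠ 0) :
    Tendsto (fun z : ℂ => u * z + v) (cobounded ℂ) (cobounded ℂ) := by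
  simp only [Metric.cobounded_eq_cocompact]
  exact ((Homeomorph.mulLeft₀ u hu).trans (Homeomorph.addRight v)).isClosedEmbedding.tendsto_cocompact

theorem moebius_continuous (g : GL (Fin 2) ℂ) : Continuous (fun z : OnePoint ℂ => g • z) := by
  have hdet : g 0 0 * g 1 1 - g 0 1 * g 1 0 ≠ 0 := by
    have := g.det_ne_zero
    rwa [Matrix.det_fin_two] at this
  have hcoe : Tendsto ((↑) : ℂ → OnePoint ℂ) (cobounded ℂ) (𝓝 OnePoint.infty) := by
    rw [Metric.cobounded_eq_cocompact, ← coclosedCompact_eq_cocompact]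
    exact OnePoint.tendsto_coe_infty
  rw [OnePoint.continuous_iff, coclosedCompact_eq_cocompact, ← Metric.cobounded_eq_cocompact]
  simp only [OnePoint.smul_some_eq_ite, OnePoint.smul_infty_eq_ite]
  by_cases hc : g 1 0 = 0
  · have hd : g 1 1 ≠ 0 := by rintro h; simp [hc, h] at hdet
    have ha : g 0 0 ≠ 0 := by rintro h; simp [hc, h] at hdet
    have e : ∀ z : ℂ, (g 0 0 * z + g 0 1) / g 1 1 = (g 0 0 / g 1 1) * z + g 0 1 / g 1 1 := by
      intro z; field_simp
    simp only [hc, zero_mul, zero_add, hd, if_true, if_false, e]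
    exact ⟨hcoe.comp (affine_tendsto_cobounded (div_ne_zero ha hd)),
      OnePoint.continuous_coe.comp (by fun_prop)⟩
  · set A := g 0 0 / g 1 0 with hA
    set B := -(g 0 0 * g 1 1 - g 0 1 * g 1 0) / g 1 0 with hB
    have hB0 : B ≠ 0 := div_ne_zero (neg_ne_zero.mpr hdet) hc
    have e : ∀ z : ℂ, g 1 0 * z + g 1 1 ≠ 0 →
        (g 0 0 * z + g 0 1) / (g 1 0 * z + g 1 1) = B * (g 1 0 * z + g 1 1)⁻¹ + A := by
      intro z hz; rw [div_eq_iff hz, add_mul, mul_assoc, inv_mul_cancel₀ hz, hA, hB]; field_simp; ring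
    simp only [hc, if_false]
    refine ⟨?_, continuous_iff_continuousAt.mpr fun p => ?_⟩
    · have h1 := affine_tendsto_cobounded (v := g 1 1) hc
      have h2 : Tendsto (fun z : ℂ => B * (g 1 0 * z + g 1 1)⁻¹ + A) (cobounded ℂ) (𝓝 A) := by
        simpa using ((tendsto_inv₀_cobounded.comp h1).const_mul B).add_const A
      refine ((OnePoint.continuous_coe.tendsto _).comp h2).congr' ?_
      filter_upwards [h1.eventually (eventually_ne_cobounded 0)] with z hz
      simp [hz, e z hz]
    · by_cases hp : g 1 0 * p + g 1 1 = 0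
      · rw [ContinuousAt, if_pos hp, ← nhdsNE_sup_pure, tendsto_sup]
        constructor
        · have hne : ∀ z, z ≠ p → g 1 0 * z + g 1 1 ≠ 0 := by
            intro z hz h
            exact hz (mul_left_cancel₀ hc (by linear_combination h - hp))
          have h1 : Tendsto (fun z : ℂ => g 1 0 * z + g 1 1) (𝓝[≠] p) (𝓝[≠] 0) := by
            refine tendsto_nhdsWithin_iff.mpr ⟨?_, ?_⟩
            · have : Continuous (fun z : ℂ => g 1 0 * z + g 1 1) := by fun_prop
              have := this.tendsto p
              rw [hp] at this
              exact this.mono_left nhdsWithin_le_nhds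
            · filter_upwards [self_mem_nhdsWithin] with z hz using hne z hz
          have h2 := (affine_tendsto_cobounded (v := A) hB0).comp (tendsto_inv₀_nhdsNE_zero.comp h1)
          refine (hcoe.comp h2).congr' ?_
          filter_upwards [self_mem_nhdsWithin] with z hz
          simp [hne z hz, e z (hne z hz)]
        · rw [tendsto_pure_left]
          intro s hs
          simpa [hp] using mem_of_mem_nhds hs
      · have hev : ∀ᶠ z in 𝓝 p, g 1 0 * z + g 1 1 ≠ 0 := by
          have : Continuous (fun z : ℂ => g 1 0 * z + g 1 1) := by fun_prop
          exact this.continuousAt.eventually_ne hp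
        have h2 : ContinuousAt (fun z : ℂ => B * (g 1 0 * z + g 1 1)⁻¹ + A) p := by
          refine ContinuousAt.add (ContinuousAt.mul continuousAt_const
            (ContinuousAt.inv₀ (by fun_prop) hp)) continuousAt_const
        refine (OnePoint.continuous_coe.continuousAt.comp h2).congr ?_
        filter_upwards [hev] with z hz
        simp [hz, e z hz]

theorem circleToSphere_smul (γ : SL(2, ℝ)) (ξ : OnePoint ℝ) :
    circleToSphere (γ • ξ) =
      ((Matrix.SpecialLinearGroup.mapGL ℝ γ).map (algebraMap ℝ ℂ)) • circleToSphere ξ :=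
  OnePoint.map_smul (algebraMap ℝ ℂ) (Matrix.SpecialLinearGroup.mapGL ℝ γ) ξ

theorem planeToSphere_smul (γ : SL(2, ℝ)) (z : ℍ) :
    planeToSphere (γ • z) =
      ((Matrix.SpecialLinearGroup.mapGL ℝ γ).map (algebraMap ℝ ℂ)) • planeToSphere z := by
  have hne : ((γ 1 0 : ℝ) : ℂ) * z + ((γ 1 1 : ℝ) : ℂ) ≠ 0 :=
    UpperHalfPlane.denom_ne_zero (Matrix.SpecialLinearGroup.mapGL ℝ γ) z
  rw [planeToSphere, planeToSphere, OnePoint.smul_some_eq_ite, coe_specialLinearGroup_apply]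
  have hne' : (algebraMap ℝ ℂ) (γ 1 0) * z + (algebraMap ℝ ℂ) (γ 1 1) ≠ 0 := hne
  simp [hne]

theorem smul_mem_idealBoundary {K : Set ℍ} {γ : SL(2, ℝ)} (hγ : ∀ z ∈ K, γ • z ∈ K)
    {ξ : OnePoint ℝ} (hξ : ξ ∈ idealBoundary K) : γ • ξ ∈ idealBoundary K := by
  have hc := moebius_continuous ((Matrix.SpecialLinearGroup.mapGL ℝ γ).map (algebraMap ℝ ℂ))
  show circleToSphere (γ • ξ) ∈ closure (planeToSphere '' K)
  rw [circleToSphere_smul]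
  refine map_mem_closure hc hξ ?_
  rintro _ ⟨z, hz, rfl⟩
  exact ⟨γ • z, hγ z hz, planeToSphere_smul γ z⟩

end Hyp

open Hyp

/-! ## Hyperbolic surfaces -/

/-- A hyperbolic metric (curvature `-1`, geodesic boundary) on an oriented surface `S`, given by
its universal cover: `region` is the universal cover of `S` with the lifted metric, identified
with a closed convex subset of the hyperbolic plane bounded by complete geodesics (the whole plane
if `S` has no boundary), and `proj` is the universal covering map, whose deck transformations are
orientation-preserving isometries, that is, are induced by elements of `SL(2, ℝ)`. The metric on
`S` is the one for which `proj` is a local isometry. -/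
structure HyperbolicMetric (S : Type*) [TopologicalSpace S] where
  region : Set ℍ
  isClosed_region : IsClosed region
  interior_nonempty : (interior region).Nonempty
  convex_region : GeodesicallyConvex region
  geodesic_frontier : GeodesicFrontier region
  proj : region → S
  isCoveringMap_proj : IsCoveringMap proj
  surjective_proj : Function.Surjective proj
  exists_deck : ∀ z w : region, proj z = proj w →
    ∃ γ : SL(2, ℝ), (∀ u : ℍ, γ • u ∈ region ↔ u ∈ region) ∧
      (∀ u v : region, γ • (u : ℍ) = v → proj u = proj v) ∧ γ • (z : ℍ) = w

namespace HyperbolicMetric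

variable {S : Type*} [TopologicalSpace S] (h : HyperbolicMetric S)

/-- The elements of `SL(2, ℝ)` inducing deck transformations of the universal cover. The group
`π₁(S)` is the image of `h.deck` in `PSL(2, ℝ)`; the matrices `1` and `-1` act trivially. -/
def deck : Subgroup SL(2, ℝ) where
  carrier := {γ | (∀ u : ℍ, γ • u ∈ h.region ↔ u ∈ h.region) ∧
    ∀ u v : h.region, γ • (u : ℍ) = v → h.proj u = h.proj v}
  one_mem' := ⟨fun u => by simp, fun u v huv => by
    rw [one_smul] at huv; rw [Subtype.ext huv]⟩
  mul_mem' := by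
    rintro a b ⟨ha, ha'⟩ ⟨hb, hb'⟩
    refine ⟨fun u => by rw [mul_smul, ha, hb], fun u v huv => ?_⟩
    rw [mul_smul] at huv
    exact (hb' u ⟨b • (u : ℍ), (hb _).mpr u.2⟩ rfl).trans (ha' _ v huv)
  inv_mem' := by
    rintro a ⟨ha, ha'⟩
    refine ⟨fun u => by rw [← ha, smul_inv_smul], fun u v huv => ?_⟩
    exact (ha' v u (by rw [← huv, smul_inv_smul])).symm

/-- The ideal boundary `∂_∞ S̃` of the universal cover. -/
def IdealBoundary : Type := {ξ : OnePoint ℝ // ξ ∈ idealBoundary h.region}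

instance : TopologicalSpace h.IdealBoundary :=
  inferInstanceAs (TopologicalSpace {ξ : OnePoint ℝ // ξ ∈ idealBoundary h.region})

instance : MulAction h.deck h.IdealBoundary where
  smul γ ξ := ⟨(γ : SL(2, ℝ)) • ξ.1,
    smul_mem_idealBoundary (fun z hz => (γ.2.1 z).mpr hz) ξ.2⟩
  one_smul ξ := Subtype.ext (one_smul SL(2, ℝ) ξ.1)
  mul_smul a b ξ := Subtype.ext (mul_smul (a : SL(2, ℝ)) (b : SL(2, ℝ)) ξ.1)

/-- `[y₁, y₂]_∞`, the ideal boundary points `y` with `y₁ ⪯ y ⪯ y₂`. -/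
def closedInterval (y₁ y₂ : h.IdealBoundary) : Set h.IdealBoundary :=
  {y | y = y₁ ∨ y = y₂ ∨ Prec y₁.1 y.1 y₂.1}

/-- `(y₁, y₂)_∞`, that is, `[y₁, y₂]_∞` without its end points. -/
def openInterval (y₁ y₂ : h.IdealBoundary) : Set h.IdealBoundary :=
  h.closedInterval y₁ y₂ \ {y₁, y₂}

/-- The space `𝒢(S̃)` of bi-infinite geodesics of the universal cover: unordered pairs of distinct
points of the ideal boundary, with the topology of a subspace of the symmetric square. -/
def Geodesics : Type := {g : Sym2 h.IdealBoundary // ¬ g.IsDiag}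

instance : TopologicalSpace h.Geodesics :=
  inferInstanceAs (TopologicalSpace {g : Sym2 h.IdealBoundary // ¬ g.IsDiag})

instance : MeasurableSpace h.Geodesics := borel h.Geodesics

instance : BorelSpace h.Geodesics := ⟨rfl⟩

/-- The diagonal action of the deck group on `𝒢(S̃)`. -/
instance : MulAction h.deck h.Geodesics where
  smul γ g := ⟨Sym2.map (fun ξ => γ • ξ) g.1, by
    rw [Sym2.isDiag_map (MulAction.injective γ)]; exact g.2⟩
  one_smul g := Subtype.ext (by
    show Sym2.map (fun ξ => (1 : h.deck) • ξ) g.1 = g.1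
    simp)
  mul_smul a b g := Subtype.ext (by
    show Sym2.map (fun ξ => (a * b) • ξ) g.1 =
      Sym2.map (fun ξ => a • ξ) (Sym2.map (fun ξ => b • ξ) g.1)
    rw [Sym2.map_map]
    congr 1
    funext ξ
    exact mul_smul a b ξ)

/-- A parametrization by arc length of the bi-infinite geodesic of the universal cover with end
points the pair `g`. -/
def IsLine (g : h.Geodesics) (η : ℝ → h.region) : Prop :=
  Isometry η ∧ ∃ a b : h.IdealBoundary, g.1 = s(a, b) ∧
    Tendsto (fun t => planeToSphere (η t : ℍ)) atBot (𝓝 (circleToSphere a.1)) ∧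
    Tendsto (fun t => planeToSphere (η t : ℍ)) atTop (𝓝 (circleToSphere b.1))

/-- The geodesic of `S` determined by `g` is closed: its parametrization by arc length is
periodic. -/
def ProjectsToClosed (g : h.Geodesics) : Prop :=
  ∃ η : ℝ → h.region, h.IsLine g η ∧ ∃ T : ℝ, 0 < T ∧ Function.Periodic (h.proj ∘ η) T

/-- Two geodesics of the universal cover intersect transversely: their pairs of end points
`x₁, x₂` and `x₁', x₂'` are linked, that is, `x₁ ≺ x₁' ≺ x₂ ≺ x₂'` for a suitable labelling. -/
def IntersectTransversely (g g' : h.Geodesics) : Prop :=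
  ∃ x₁ x₂ x₁' x₂' : h.IdealBoundary, g.1 = s(x₁, x₂) ∧ g'.1 = s(x₁', x₂') ∧
    Prec x₁.1 x₁'.1 x₂.1 ∧ Prec x₂.1 x₂'.1 x₁.1

/-- The geodesics of `S` determined by `g` and `g'` cross transversely: some of their lifts
do. -/
def CrossInSurface (g g' : h.Geodesics) : Prop :=
  ∃ γ : h.deck, h.IntersectTransversely g (γ • g')

/-- A geodesic current on `S`: a locally finite Borel measure on `𝒢(S̃)` that is invariant under
the deck group. -/
structure IsCurrent (c : Measure h.Geodesics) : Prop where
  locallyFinite : IsLocallyFiniteMeasure c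
  invariant : ∀ (γ : h.deck) (A : Set h.Geodesics), MeasurableSet A →
    c ((fun g => γ • g) ⁻¹' A) = c A

/-- `{x} × Y`, the geodesics that join `x` to a point of `Y`. -/
def fan (x : h.IdealBoundary) (Y : Set h.IdealBoundary) : Set h.Geodesics :=
  {g | ∃ y ∈ Y, g.1 = s(x, y)}

end HyperbolicMetric

end

/-- Sets of measure bounded below inside a set of finite measure have a common point infinitely
often. -/
theorem MeasureTheory.exists_frequently_mem_of_le_measure {α : Type*} [MeasurableSpace α]
    {μ : Measure α} {F : Set α} (hF : μ F ≠ ⊤) {B : ℕ → Set α} (hB : ∀ n, MeasurableSet (B n))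
    (hBF : ∀ n, B n ⊆ F) {a : ENNReal} (ha : a ≠ 0) (haB : ∀ n, a ≤ μ (B n)) :
    ∃ x, ∃ᶠ n in atTop, x ∈ B n := by
  by_contra! hcon
  have hD : ⋂ n, ⋃ m ≥ n, B m = ∅ := by
    ext x
    simp only [Set.mem_iInter, Set.mem_iUnion, Set.mem_empty_iff_false, iff_false, not_forall]
    obtain ⟨N, hN⟩ := eventually_atTop.mp (hcon x)
    exact ⟨N, by simpa using hN⟩
  have hlim := tendsto_measure_iInter_atTop (μ := μ) (s := fun n => ⋃ m ≥ n, B m)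
    (fun n => (MeasurableSet.biUnion (Set.to_countable _) fun m _ => hB m).nullMeasurableSet)
    (fun i j hij => Set.biUnion_subset_biUnion_left fun m hm => le_trans hij hm)
    ⟨0, ne_top_of_le_ne_top hF (measure_mono (Set.iUnion₂_subset fun m _ => hBF m))⟩
  rw [hD, measure_empty] at hlim
  refine ha (le_antisymm (ge_of_tendsto' hlim fun n => (haB n).trans (measure_mono ?_)) bot_le)
  exact Set.subset_biUnion_of_mem (u := B) (le_refl n)

namespace Hyp

/-! ### Geodesic convexity in the upper half-plane -/

/-- In the chart `z ↦ (re z, |z|²)` geodesics are straight: a point whose image is a convex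
combination of the images of two points lies on the geodesic segment between them. -/
theorem dist_add_dist_of_convexComb {w u z : ℍ} {s : ℝ} (hs0 : 0 ≤ s) (hs1 : s ≤ 1)
    (hre : u.re = (1 - s) * w.re + s * z.re)
    (hsq : u.re ^ 2 + u.im ^ 2 = (1 - s) * (w.re ^ 2 + w.im ^ 2) + s * (z.re ^ 2 + z.im ^ 2)) :
    dist w u + dist u z = dist w z := by
  have hw := w.im_pos
  have hu := u.im_pos
  have hz := z.im_pos
  set B := Real.cosh (dist w z) with hB
  set l := (1 - s) * w.im / u.im with hl
  set m := s * z.im / u.im with hm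
  have hl0 : 0 ≤ l := div_nonneg (mul_nonneg (by linarith) hw.le) hu.le
  have hm0 : 0 ≤ m := div_nonneg (mul_nonneg hs0 hz.le) hu.le
  have hBe : 2 * w.im * z.im * B = (w.re - z.re) ^ 2 + w.im ^ 2 + z.im ^ 2 := by
    rw [hB, cosh_dist']; field_simp
  have hα : Real.cosh (dist w u) = l + m * B := by
    have : 2 * w.im * u.im * (l + m * B) = (w.re - u.re) ^ 2 + w.im ^ 2 + u.im ^ 2 := by
      have e : 2 * w.im * u.im * (l + m * B)
          = 2 * w.im * ((1 - s) * w.im) + s * (2 * w.im * z.im * B) := by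
        rw [hl, hm]; field_simp
      rw [e, hBe]
      linear_combination -hsq + 2 * w.re * hre
    rw [cosh_dist', ← this]; field_simp
  have hβ : Real.cosh (dist u z) = l * B + m := by
    have : 2 * u.im * z.im * (l * B + m) = (u.re - z.re) ^ 2 + u.im ^ 2 + z.im ^ 2 := by
      have e : 2 * u.im * z.im * (l * B + m)
          = 2 * z.im * (s * z.im) + (1 - s) * (2 * w.im * z.im * B) := by
        rw [hl, hm]; field_simp; ring
      rw [e, hBe]
      linear_combination -hsq + 2 * z.re * hre
    rw [cosh_dist', ← this]; field_simp
  have hone : l ^ 2 + m ^ 2 + 2 * l * m * B = 1 := by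
    have e : u.im ^ 2 * (l ^ 2 + m ^ 2 + 2 * l * m * B)
        = (1 - s) ^ 2 * w.im ^ 2 + s ^ 2 * z.im ^ 2
          + s * (1 - s) * (2 * w.im * z.im * B) := by
      rw [hl, hm]; field_simp
    have : u.im ^ 2 * (l ^ 2 + m ^ 2 + 2 * l * m * B) = u.im ^ 2 * 1 := by
      rw [e, hBe]
      linear_combination -hsq + (u.re + (1 - s) * w.re + s * z.re) * hre
    exact mul_left_cancel₀ (by positivity) this
  have hS0 : 0 ≤ Real.sinh (dist w z) := Real.sinh_nonneg_iff.mpr dist_nonneg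
  have hS : Real.sinh (dist w z) ^ 2 = B ^ 2 - 1 := Real.sinh_sq _
  have hsα : Real.sinh (dist w u) = m * Real.sinh (dist w z) := by
    refine (sq_eq_sq₀ (Real.sinh_nonneg_iff.mpr dist_nonneg) (mul_nonneg hm0 hS0)).mp ?_
    rw [Real.sinh_sq, hα, mul_pow, hS]
    linear_combination hone
  have hsβ : Real.sinh (dist u z) = l * Real.sinh (dist w z) := by
    refine (sq_eq_sq₀ (Real.sinh_nonneg_iff.mpr dist_nonneg) (mul_nonneg hl0 hS0)).mp ?_
    rw [Real.sinh_sq, hβ, mul_pow, hS]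
    linear_combination hone
  apply Real.sinh_injective
  rw [Real.sinh_add, hα, hβ, hsα, hsβ]
  linear_combination Real.sinh (dist w z) * hone

theorem mem_idealBoundary_of_tendsto {ι : Type*} {l : Filter ι} [l.NeBot] {K : Set ℍ}
    {ξ : OnePoint ℝ} {f : ι → ℍ} (hf : ∀ i, f i ∈ K)
    (hlim : Tendsto (fun i => planeToSphere (f i)) l (𝓝 (circleToSphere ξ))) :
    ξ ∈ idealBoundary K :=
  mem_closure_of_tendsto hlim (Eventually.of_forall fun i => ⟨f i, hf i, rfl⟩)

theorem exists_tendsto_of_mem_idealBoundary {K : Set ℍ} {ξ : OnePoint ℝ}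
    (hξ : ξ ∈ idealBoundary K) :
    ∃ l : Filter ℍ, l.NeBot ∧ (∀ᶠ z in l, z ∈ K) ∧
      Tendsto planeToSphere l (𝓝 (circleToSphere ξ)) := by
  refine ⟨comap planeToSphere (𝓝 (circleToSphere ξ)) ⊓ 𝓟 K, ?_,
    mem_inf_of_right (mem_principal_self K), tendsto_comap.mono_left inf_le_left⟩
  rw [inf_comm, ← map_neBot_iff planeToSphere, Filter.push_pull, map_principal, inf_comm]
  exact mem_closure_iff_clusterPt.mp hξ

theorem tendsto_planeToSphere_coe {ι : Type*} {l : Filter ι} {f : ι → ℍ} {t : ℂ} :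
    Tendsto (fun i => planeToSphere (f i)) l (𝓝 (t : OnePoint ℂ)) ↔
      Tendsto (fun i => (f i : ℂ)) l (𝓝 t) :=
  (OnePoint.isOpenEmbedding_coe.isInducing.tendsto_nhds_iff).symm

theorem tendsto_planeToSphere_infty {ι : Type*} {l : Filter ι} {f : ι → ℍ} :
    Tendsto (fun i => planeToSphere (f i)) l (𝓝 OnePoint.infty) ↔
      Tendsto (fun i => (f i : ℂ)) l (cobounded ℂ) := by
  rw [Metric.cobounded_eq_cocompact, ← coclosedCompact_eq_cocompact,
    ← OnePoint.comap_coe_nhds_infty, tendsto_comap_iff]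
  rfl

/-- The point `t + i T` of the upper half-plane. -/
abbrev vertical (t : ℝ) {T : ℝ} (hT : 0 < T) : ℍ := ⟨⟨t, T⟩, hT⟩

theorem vertical_mem_of_mem_idealBoundary {K : Set ℍ} (hK : IsClosed K)
    (hconv : GeodesicallyConvex K) (hinf : OnePoint.infty ∈ idealBoundary K) {t : ℝ}
    (ht : (t : OnePoint ℝ) ∈ idealBoundary K) {T : ℝ} (hT : 0 < T) : vertical t hT ∈ K := by
  obtain ⟨l₁, _, hK₁, hl₁⟩ := exists_tendsto_of_mem_idealBoundary ht
  obtain ⟨l₂, _, hK₂, hl₂⟩ := exists_tendsto_of_mem_idealBoundary hinf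
  replace hl₁ : Tendsto (fun z : ℍ => (z : ℂ)) l₁ (𝓝 (t : ℂ)) := tendsto_planeToSphere_coe.mp hl₁
  replace hl₂ : Tendsto (fun z : ℍ => (z : ℂ)) l₂ (cobounded ℂ) :=
    tendsto_planeToSphere_infty.mp hl₂
  have hre : Tendsto (fun p : ℍ × ℍ => p.1.re) (l₁ ×ˢ l₂) (𝓝 t) :=
    ((Complex.continuous_re.tendsto _).comp hl₁).comp tendsto_fst
  have him : Tendsto (fun p : ℍ × ℍ => p.1.im) (l₁ ×ˢ l₂) (𝓝 0) :=
    ((Complex.continuous_im.tendsto _).comp hl₁).comp tendsto_fst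
  have hnorm : Tendsto (fun p : ℍ × ℍ => ‖(p.2 : ℂ)‖) (l₁ ×ˢ l₂) atTop :=
    (tendsto_norm_cobounded_atTop.comp hl₂).comp tendsto_snd
  set Q := t ^ 2 + T ^ 2 with hQ
  set s : ℍ × ℍ → ℝ := fun p => (Q - (p.1.re ^ 2 + p.1.im ^ 2)) /
    (‖(p.2 : ℂ)‖ ^ 2 - (p.1.re ^ 2 + p.1.im ^ 2)) with hs
  have hq : Tendsto (fun p : ℍ × ℍ => p.1.re ^ 2 + p.1.im ^ 2) (l₁ ×ˢ l₂) (𝓝 (t ^ 2)) := by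
    simpa using (hre.pow 2).add (him.pow 2)
  have hN : Tendsto (fun p : ℍ × ℍ => ‖(p.2 : ℂ)‖ ^ 2 - (p.1.re ^ 2 + p.1.im ^ 2))
      (l₁ ×ˢ l₂) atTop := by
    simpa [sub_eq_add_neg] using
      ((tendsto_pow_atTop two_ne_zero).comp hnorm).atTop_add (tendsto_neg (t ^ 2) |>.comp hq)
  have hnum : Tendsto (fun p : ℍ × ℍ => Q - (p.1.re ^ 2 + p.1.im ^ 2)) (l₁ ×ˢ l₂)
      (𝓝 (T ^ 2)) := by
    have := hq.const_sub Q
    rwa [hQ, add_sub_cancel_left] at this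
  have hs_lim : Tendsto s (l₁ ×ˢ l₂) (𝓝 0) := hnum.div_atTop hN
  have hsz : Tendsto (fun p => s p * p.2.re) (l₁ ×ˢ l₂) (𝓝 0) := by
    have h1 : Tendsto (fun p : ℍ × ℍ => ‖(p.2 : ℂ)‖ ^ 2 /
        (‖(p.2 : ℂ)‖ ^ 2 - (p.1.re ^ 2 + p.1.im ^ 2))) (l₁ ×ˢ l₂) (𝓝 1) := by
      have h2 : Tendsto (fun p : ℍ × ℍ => 1 + (p.1.re ^ 2 + p.1.im ^ 2) /
          (‖(p.2 : ℂ)‖ ^ 2 - (p.1.re ^ 2 + p.1.im ^ 2))) (l₁ ×ˢ l₂) (𝓝 (1 + 0)) :=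
        (hq.div_atTop hN).const_add 1
      rw [add_zero] at h2
      refine h2.congr' ?_
      filter_upwards [hN.eventually_gt_atTop 0] with p hp
      field_simp
      ring
    have h3 : Tendsto (fun p : ℍ × ℍ => (Q - (p.1.re ^ 2 + p.1.im ^ 2)) *
        (‖(p.2 : ℂ)‖ ^ 2 / (‖(p.2 : ℂ)‖ ^ 2 - (p.1.re ^ 2 + p.1.im ^ 2))) / ‖(p.2 : ℂ)‖)
        (l₁ ×ˢ l₂) (𝓝 0) := (hnum.mul h1).div_atTop hnorm
    refine squeeze_zero_norm' ?_ (tendsto_norm_zero.comp h3)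
    filter_upwards [hnorm.eventually_gt_atTop 0] with p hp
    have e : (Q - (p.1.re ^ 2 + p.1.im ^ 2)) *
        (‖(p.2 : ℂ)‖ ^ 2 / (‖(p.2 : ℂ)‖ ^ 2 - (p.1.re ^ 2 + p.1.im ^ 2))) / ‖(p.2 : ℂ)‖
        = s p * ‖(p.2 : ℂ)‖ := by
      rw [hs]; field_simp
    simp only [Function.comp_apply]
    rw [e, norm_mul, norm_mul, norm_norm]
    gcongr
    exact Complex.abs_re_le_norm _
  set X : ℍ × ℍ → ℝ := fun p => (1 - s p) * p.1.re + s p * p.2.re with hX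
  have hXlim : Tendsto X (l₁ ×ˢ l₂) (𝓝 t) := by
    simpa using ((hs_lim.const_sub 1).mul hre).add hsz
  have hYlim : Tendsto (fun p => √(Q - X p ^ 2)) (l₁ ×ˢ l₂) (𝓝 T) := by
    have := (Real.continuous_sqrt.tendsto _).comp ((hXlim.pow 2).const_sub Q)
    rwa [hQ, add_sub_cancel_left, Real.sqrt_sq hT.le] at this
  have hlim : Tendsto (fun p => ofComplex (⟨X p, √(Q - X p ^ 2)⟩ : ℂ)) (l₁ ×ˢ l₂)
      (𝓝 (vertical t hT)) := by
    have h1 : Tendsto (fun p => (⟨X p, √(Q - X p ^ 2)⟩ : ℂ)) (l₁ ×ˢ l₂)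
        (𝓝 (vertical t hT : ℂ)) := by
      have := (Complex.equivRealProdCLM.symm.continuous.tendsto (t, T)).comp
        (hXlim.prodMk_nhds hYlim)
      exact this
    have h2 : Tendsto ofComplex (𝓝 (vertical t hT : ℂ)) (𝓝 (vertical t hT)) := by
      rw [UpperHalfPlane.isEmbedding_coe.tendsto_nhds_iff]
      exact tendsto_id.congr' (eventuallyEq_coe_comp_ofComplex hT).symm
    exact h2.comp h1
  refine hK.mem_of_tendsto hlim ?_
  filter_upwards [prod_mem_prod hK₁ hK₂, hnum.eventually_const_lt (show (0 : ℝ) < T ^ 2 by positivity),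
    hN.eventually_gt_atTop 0, hs_lim.eventually_le_const (show (0 : ℝ) < 1 by norm_num),
    hYlim.eventually_const_lt hT] with p hp h1 h2 h3 h4
  refine hconv p.1 hp.1 p.2 hp.2 _ ?_
  have hu : ofComplex (⟨X p, √(Q - X p ^ 2)⟩ : ℂ) = ⟨⟨X p, √(Q - X p ^ 2)⟩, h4⟩ :=
    ofComplex_apply_of_im_pos h4
  have hsqn : ‖(p.2 : ℂ)‖ ^ 2 = p.2.re ^ 2 + p.2.im ^ 2 := by
    rw [Complex.sq_norm, Complex.normSq_apply]; simp [sq]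
  rw [hu]
  refine dist_add_dist_of_convexComb (div_nonneg h1.le h2.le) h3 rfl ?_
  show X p ^ 2 + √(Q - X p ^ 2) ^ 2 = _
  rw [Real.sq_sqrt (Real.sqrt_pos.mp h4).le]
  have : s p * (‖(p.2 : ℂ)‖ ^ 2 - (p.1.re ^ 2 + p.1.im ^ 2)) = Q - (p.1.re ^ 2 + p.1.im ^ 2) :=
    div_mul_cancel₀ _ h2.ne'
  change X p ^ 2 + (Q - X p ^ 2) = (1 - s p) * _ + s p * _
  rw [← hsqn]
  linear_combination -this

/-! ### The circle at infinity -/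

theorem smul_infty (γ : SL(2, ℝ)) :
    γ • (OnePoint.infty : OnePoint ℝ) =
      if γ 1 0 = 0 then OnePoint.infty else ((γ 0 0 / γ 1 0 : ℝ) : OnePoint ℝ) :=
  OnePoint.smul_infty_eq_ite (Matrix.SpecialLinearGroup.mapGL ℝ γ)

theorem smul_coe (γ : SL(2, ℝ)) (t : ℝ) :
    γ • (t : OnePoint ℝ) =
      if γ 1 0 * t + γ 1 1 = 0 then OnePoint.infty
      else (((γ 0 0 * t + γ 0 1) / (γ 1 0 * t + γ 1 1) : ℝ) : OnePoint ℝ) :=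
  OnePoint.smul_some_eq_ite (g := Matrix.SpecialLinearGroup.mapGL ℝ γ) (k := t)

theorem exists_smul_infty_eq (ξ : OnePoint ℝ) :
    ∃ σ : SL(2, ℝ), σ • (OnePoint.infty : OnePoint ℝ) = ξ := by
  induction ξ using OnePoint.rec with
  | infty => exact ⟨1, one_smul _ _⟩
  | coe t =>
    refine ⟨⟨!![t, -1; 1, 0], by simp [Matrix.det_fin_two]⟩, ?_⟩
    exact (smul_infty _).trans (by simp)

theorem continuous_circleToSphere : Continuous circleToSphere := by
  refine OnePoint.continuous_map Complex.continuous_ofReal ?_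
  rw [coclosedCompact_eq_cocompact, coclosedCompact_eq_cocompact]
  exact Complex.isometry_ofReal.isClosedEmbedding.tendsto_cocompact

theorem injective_circleToSphere : Function.Injective circleToSphere :=
  Option.map_injective Complex.ofReal_injective

theorem continuous_smul_circle (γ : SL(2, ℝ)) : Continuous (fun ξ : OnePoint ℝ => γ • ξ) := by
  have hemb := continuous_circleToSphere.isClosedEmbedding injective_circleToSphere
  rw [hemb.isInducing.continuous_iff]
  have : circleToSphere ∘ (fun ξ : OnePoint ℝ => γ • ξ) =
      fun ξ => ((Matrix.SpecialLinearGroup.mapGL ℝ γ).map (algebraMap ℝ ℂ)) • circleToSphere ξ :=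
    funext fun ξ => circleToSphere_smul γ ξ
  rw [this]
  exact (moebius_continuous _).comp continuous_circleToSphere

theorem continuous_smul_plane (γ : SL(2, ℝ)) : Continuous (fun z : ℍ => γ • z) :=
  (isometry_smul ℍ γ).continuous

theorem smul_mem_idealBoundary_of_mapsTo {K K' : Set ℍ} {γ : SL(2, ℝ)}
    (hγ : ∀ z ∈ K, γ • z ∈ K') {ξ : OnePoint ℝ} (hξ : ξ ∈ idealBoundary K) :
    γ • ξ ∈ idealBoundary K' := by
  have hc := moebius_continuous ((Matrix.SpecialLinearGroup.mapGL ℝ γ).map (algebraMap ℝ ℂ))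
  show circleToSphere (γ • ξ) ∈ closure (planeToSphere '' K')
  rw [circleToSphere_smul]
  refine map_mem_closure hc hξ ?_
  rintro _ ⟨z, hz, rfl⟩
  exact ⟨γ • z, hγ z hz, planeToSphere_smul γ z⟩

theorem smul_mem_idealBoundary_iff {K : Set ℍ} {σ : SL(2, ℝ)} {ξ : OnePoint ℝ} :
    σ • ξ ∈ idealBoundary K ↔ ξ ∈ idealBoundary {z : ℍ | σ • z ∈ K} := by
  refine ⟨fun h => ?_, fun h => smul_mem_idealBoundary_of_mapsTo (fun z hz => hz) h⟩
  rw [← inv_smul_smul σ ξ]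
  exact smul_mem_idealBoundary_of_mapsTo (fun z hz => by simpa using hz) h

theorem isClosed_idealBoundary (K : Set ℍ) : IsClosed (idealBoundary K) :=
  isClosed_closure.preimage continuous_circleToSphere

theorem GeodesicallyConvex.preimage_smul {K : Set ℍ} (hK : GeodesicallyConvex K) (σ : SL(2, ℝ)) :
    GeodesicallyConvex {z : ℍ | σ • z ∈ K} := by
  intro z hz w hw u hu
  refine hK _ hz _ hw _ ?_
  simpa only [dist_smul] using hu

/-- The Cayley transform, from the circle at infinity to the unit circle. -/
noncomputable def cayley (ξ : OnePoint ℝ) : ℂ :=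
  ξ.elim 1 (fun t : ℝ => ((t : ℂ) - Complex.I) / (t + Complex.I))

theorem ofReal_add_mul_I_ne_zero {p q : ℝ} (h : p ≠ 0 ∨ q ≠ 0) : (p + q * Complex.I : ℂ) ≠ 0 := by
  intro h0
  have h1 := congrArg Complex.re h0
  have h2 := congrArg Complex.im h0
  simp at h1 h2
  tauto

theorem cayley_homogeneous {p q : ℝ} (h : p ≠ 0 ∨ q ≠ 0) :
    cayley (if q = 0 then OnePoint.infty else ((p / q : ℝ) : OnePoint ℝ)) =
      (p - q * Complex.I) / (p + q * Complex.I) := by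
  have hne := ofReal_add_mul_I_ne_zero h
  split_ifs with hq
  · have hp : (p : ℂ) ≠ 0 := by simpa [hq] using h
    show (1 : ℂ) = _
    simp [hq, hp]
  · show (((p / q : ℝ) : ℂ) - Complex.I) / ((p / q : ℝ) + Complex.I) = _
    have hq' : (q : ℂ) ≠ 0 := by exact_mod_cast hq
    have h1 : (((p / q : ℝ) : ℂ) - Complex.I) = (p - q * Complex.I) / q := by
      push_cast; field_simp
    have h2 : (((p / q : ℝ) : ℂ) + Complex.I) = (p + q * Complex.I) / q := by
      push_cast; field_simp
    rw [h1, h2, div_div_div_cancel_right₀ hq']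

theorem continuous_cayley : Continuous cayley := by
  rw [OnePoint.continuous_iff]
  have hne : ∀ t : ℝ, (t : ℂ) + Complex.I ≠ 0 := fun t => by
    simpa using ofReal_add_mul_I_ne_zero (p := t) (q := 1) (Or.inr one_ne_zero)
  constructor
  · have h1 : Tendsto (fun t : ℝ => (t : ℂ)) (coclosedCompact ℝ) (cobounded ℂ) := by
      rw [Metric.cobounded_eq_cocompact, coclosedCompact_eq_cocompact]
      exact Complex.isometry_ofReal.isClosedEmbedding.tendsto_cocompact
    have h2 : Tendsto (fun t : ℝ => (t : ℂ) + Complex.I) (coclosedCompact ℝ) (cobounded ℂ) := by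
      refine ((affine_tendsto_cobounded (v := Complex.I) one_ne_zero).comp h1).congr fun t => ?_
      simp
    have h3 : Tendsto (fun t : ℝ => 1 - 2 * Complex.I * ((t : ℂ) + Complex.I)⁻¹)
        (coclosedCompact ℝ) (𝓝 1) := by
      simpa using ((tendsto_inv₀_cobounded.comp h2).const_mul (2 * Complex.I)).const_sub 1
    refine h3.congr fun t => ?_
    have := hne t
    show _ = ((t : ℂ) - Complex.I) / (t + Complex.I)
    field_simp
    ring
  · show Continuous fun t : ℝ => ((t : ℂ) - Complex.I) / (t + Complex.I)
    exact (by fun_prop : Continuous fun t : ℝ => (t : ℂ) - Complex.I).div (by fun_prop) hne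

theorem injective_cayley : Function.Injective cayley := by
  have hne : ∀ t : ℝ, (t : ℂ) + Complex.I ≠ 0 := fun t => by
    simpa using ofReal_add_mul_I_ne_zero (p := t) (q := 1) (Or.inr one_ne_zero)
  have h1 : ∀ t : ℝ, cayley (t : OnePoint ℝ) ≠ 1 := by
    intro t h
    change ((t : ℂ) - Complex.I) / (t + Complex.I) = 1 at h
    rw [div_eq_one_iff_eq (hne t)] at h
    have := congrArg Complex.im h
    norm_num at this
  intro a b hab
  induction a using OnePoint.rec with
  | infty =>
    induction b using OnePoint.rec with
    | infty => rfl
    | coe t => exact absurd hab.symm (h1 t)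
  | coe s =>
    induction b using OnePoint.rec with
    | infty => exact absurd hab (h1 s)
    | coe t =>
      change ((s : ℂ) - Complex.I) / (s + Complex.I) = ((t : ℂ) - Complex.I) / (t + Complex.I) at hab
      rw [div_eq_div_iff (hne s) (hne t)] at hab
      have := congrArg Complex.im hab
      simp at this
      congr 1
      linarith

instance : SecondCountableTopology (OnePoint ℝ) :=
  (continuous_cayley.isClosedEmbedding injective_cayley).isInducing.secondCountableTopology

/-- The images under `γ` of `∞` and of a point of `[-1, 1]` stay apart, in terms of the position
of `γ • i`. -/
theorem inv_le_norm_cayley_sub {γ : SL(2, ℝ)} {s M : ℝ} (hs : |s| ≤ 1)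
    (hM : (1 + Complex.normSq ((γ • I : ℍ) : ℂ)) / (γ • I : ℍ).im ≤ M) :
    1 / M ≤ ‖cayley (γ • OnePoint.infty) - cayley (γ • (s : OnePoint ℝ))‖ := by
  set a := γ 0 0 with ha
  set b := γ 0 1 with hb
  set c := γ 1 0 with hc
  set d := γ 1 1 with hd
  have hdet : a * d - b * c = 1 := by
    have := γ.det_coe
    rwa [Matrix.det_fin_two] at this
  have hcd : 0 < c ^ 2 + d ^ 2 := by
    by_contra! h
    have h1 : c = 0 := by nlinarith [sq_nonneg c, sq_nonneg d]
    have h2 : d = 0 := by nlinarith [sq_nonneg c, sq_nonneg d]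
    simp [h1, h2] at hdet
  have hfrob : a ^ 2 + b ^ 2 + c ^ 2 + d ^ 2 ≤ M := by
    refine le_trans (le_of_eq ?_) hM
    have hne : (d + c * Complex.I : ℂ) ≠ 0 := ofReal_add_mul_I_ne_zero (by
      by_contra! h
      simp [h.1, h.2] at hcd)
    have hn : Complex.normSq (c * Complex.I + d : ℂ) = c ^ 2 + d ^ 2 := by
      simp [Complex.normSq_apply]; ring
    have hn' : Complex.normSq (a * Complex.I + b : ℂ) = a ^ 2 + b ^ 2 := by
      simp [Complex.normSq_apply]; ring
    have he : ((γ • I : ℍ) : ℂ) = (a * Complex.I + b) / (c * Complex.I + d) := by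
      rw [coe_specialLinearGroup_apply]; simp [← ha, ← hb, ← hc, ← hd]
    have him : (γ • I : ℍ).im = 1 / (c ^ 2 + d ^ 2) := by
      rw [← coe_im, he, Complex.div_im, hn]
      simp
      field_simp
      linear_combination hdet
    rw [him, he, Complex.normSq_div, hn, hn']
    field_simp
    ring
  have hP : a ≠ 0 ∨ c ≠ 0 := by
    by_contra! h
    simp [h.1, h.2] at hdet
  have hQ : a * s + b ≠ 0 ∨ c * s + d ≠ 0 := by
    by_contra! h
    have : a * d - b * c = 0 := by linear_combination a * h.2 - c * h.1
    linarith
  have hM0 : 0 < M := by linarith [sq_nonneg a, sq_nonneg b]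
  have hs2 : s ^ 2 ≤ 1 := by rw [← sq_abs]; nlinarith [abs_nonneg s]
  rw [smul_infty, smul_coe, cayley_homogeneous hP, cayley_homogeneous hQ]
  have h1 := ofReal_add_mul_I_ne_zero hP
  have h2 := ofReal_add_mul_I_ne_zero hQ
  rw [div_sub_div _ _ h1 h2, norm_div, norm_mul]
  have hnum : ((a : ℂ) - c * Complex.I) * ((a * s + b : ℝ) + (c * s + d : ℝ) * Complex.I) -
      (a + c * Complex.I) * ((a * s + b : ℝ) - (c * s + d : ℝ) * Complex.I) = 2 * Complex.I := by
    have : ((a * d - b * c : ℝ) : ℂ) = 1 := by rw [hdet]; simp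
    push_cast at this ⊢
    linear_combination 2 * Complex.I * this
  have hnorm : ‖(2 * Complex.I : ℂ)‖ = 2 := by simp
  rw [hnum, hnorm]
  have n1 : ‖(a + c * Complex.I : ℂ)‖ ^ 2 ≤ M := by
    rw [Complex.sq_norm, Complex.normSq_add_mul_I]
    nlinarith [sq_nonneg b, sq_nonneg d]
  have n2 : ‖((a * s + b : ℝ) + (c * s + d : ℝ) * Complex.I : ℂ)‖ ^ 2 ≤ 2 * M := by
    rw [Complex.sq_norm, Complex.normSq_add_mul_I]
    nlinarith [sq_nonneg (a - b * s), sq_nonneg (c - d * s), sq_nonneg a, sq_nonneg b,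
      sq_nonneg c, sq_nonneg d]
  rw [div_le_div_iff₀ hM0 (mul_pos (norm_pos_iff.mpr h1) (norm_pos_iff.mpr h2))]
  nlinarith [sq_nonneg (‖(a + c * Complex.I : ℂ)‖ -
    ‖((a * s + b : ℝ) + (c * s + d : ℝ) * Complex.I : ℂ)‖)]

/-! ### The cyclic order -/

theorem injective_cutCircle : Function.Injective cutCircle := by
  intro a b hab
  induction a using OnePoint.rec <;> induction b using OnePoint.rec <;>
    simp_all [cutCircle]

theorem isOpen_setOf_prec (a b : OnePoint ℝ) : IsOpen {z | Prec a z b} := by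
  have hIoo : ∀ s : Set ℝ, IsOpen s → IsOpen ((↑) '' s : Set (OnePoint ℝ)) := fun s hs =>
    OnePoint.isOpenEmbedding_coe.isOpenMap s hs
  have hco : ∀ s : Set ℝ, IsCompact s → IsOpen ((↑) '' s : Set (OnePoint ℝ))ᶜ := fun s hs =>
    (hs.image OnePoint.continuous_coe).isClosed.isOpen_compl
  induction a using OnePoint.rec with
  | infty =>
    induction b using OnePoint.rec with
    | infty =>
      convert isOpen_empty
      ext z
      simp [Prec, cutCircle]
    | coe b =>
      convert hIoo (Set.Iio b) isOpen_Iio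
      ext z
      induction z using OnePoint.rec <;> simp [Prec, cutCircle]
  | coe a =>
    induction b using OnePoint.rec with
    | infty =>
      convert hIoo (Set.Ioi a) isOpen_Ioi
      ext z
      induction z using OnePoint.rec <;> simp [Prec, cutCircle]
    | coe b =>
      rcases lt_or_ge b a with h | h
      · convert hco (Set.Icc b a) isCompact_Icc
        ext z
        induction z using OnePoint.rec <;> simp [Prec, cutCircle] <;> grind
      · convert hIoo (Set.Ioo a b) isOpen_Ioo
        ext z
        induction z using OnePoint.rec <;> simp [Prec, cutCircle] <;> grind

theorem prec_of_not_prec {x y y₁ y₂ : OnePoint ℝ} (hy : Prec y₁ y y₂) (h₁ : x ≠ y₁) (h₂ : x ≠ y₂)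
    (hx : ¬ Prec y₁ x y₂) : Prec y₂ x y₁ := by
  replace h₁ := injective_cutCircle.ne h₁
  replace h₂ := injective_cutCircle.ne h₂
  unfold Prec at *
  grind

/-- Let `y'` lie in the arc `(y₁, y₂)` and let `x`, `x'` be distinct points of the opposite arc.
Then `{x', y'}` is linked with one of `{x, y₁}` and `{x, y₂}`. -/
theorem linked_of_prec {x x' y' y₁ y₂ : OnePoint ℝ} (hy : Prec y₁ y' y₂) (hx : Prec y₂ x y₁)
    (hx' : Prec y₂ x' y₁) (hne : x' ≠ x) :
    (Prec x' y₁ y' ∧ Prec y' x x') ∨ (Prec y' y₂ x' ∧ Prec x' x y') := by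
  replace hne := injective_cutCircle.ne hne
  unfold Prec at *
  grind

/-! ### Affine elements and vertical geodesics -/

/-- An element of `SL(2, ℝ)` fixing `∞` acts by an affine map. -/
theorem exists_affine_of_smul_infty {τ : SL(2, ℝ)}
    (hτ : τ • (OnePoint.infty : OnePoint ℝ) = OnePoint.infty) :
    ∃ a b : ℝ, 0 < a ∧ (∀ z : ℍ, ((τ • z : ℍ) : ℂ) = a * z + b) ∧
      ∀ s : ℝ, τ • (s : OnePoint ℝ) = ((a * s + b : ℝ) : OnePoint ℝ) := by
  have hc : τ 1 0 = 0 := by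
    rw [smul_infty] at hτ
    by_contra h
    simp [h] at hτ
  have hdet : τ 0 0 * τ 1 1 = 1 := by
    have := τ.det_coe
    rw [Matrix.det_fin_two] at this
    simpa [hc] using this
  have hd : τ 1 1 ≠ 0 := right_ne_zero_of_mul_eq_one hdet
  have ha : τ 0 0 ≠ 0 := left_ne_zero_of_mul_eq_one hdet
  have hd' : ((τ 1 1 : ℝ) : ℂ) ≠ 0 := by exact_mod_cast hd
  refine ⟨τ 0 0 / τ 1 1, τ 0 1 / τ 1 1, ?_, fun z => ?_, fun s => ?_⟩
  · have : τ 0 0 / τ 1 1 = τ 0 0 ^ 2 := by field_simp; linear_combination -hdet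
    rw [this]; positivity
  · rw [coe_specialLinearGroup_apply]
    simp [hc]
    field_simp
  · rw [smul_coe]
    simp [hc, hd]
    field_simp

/-- The affine map `s ↦ T s + t` is induced by an element of `SL(2, ℝ)`. -/
theorem exists_smul_I_eq_vertical (t : ℝ) {T : ℝ} (hT : 0 < T) :
    ∃ τ : SL(2, ℝ), τ • (OnePoint.infty : OnePoint ℝ) = OnePoint.infty ∧
      τ • I = vertical t hT ∧ ∀ s : ℝ, τ • (s : OnePoint ℝ) = ((T * s + t : ℝ) : OnePoint ℝ) := by
  have hs : √T ≠ 0 := (Real.sqrt_pos.mpr hT).ne'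
  have hsq : √T * √T = T := Real.mul_self_sqrt hT.le
  have hsq' : ((√T : ℝ) : ℂ) * (√T : ℝ) = T := by exact_mod_cast hsq
  have hs' : ((√T : ℝ) : ℂ) ≠ 0 := by exact_mod_cast hs
  refine ⟨⟨!![√T, t / √T; 0, 1 / √T], by simp [Matrix.det_fin_two, hs]⟩, ?_, ?_, fun s => ?_⟩
  · exact (smul_infty _).trans (by simp)
  · apply UpperHalfPlane.ext
    refine (coe_specialLinearGroup_apply _ _).trans ?_
    have : (⟨t, T⟩ : ℂ) = t + T * Complex.I := Complex.mk_eq_add_mul_I t T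
    change _ = (⟨t, T⟩ : ℂ)
    rw [this, ← hsq']
    simp
    field_simp
    ring
  · refine (smul_coe _ _).trans ?_
    simp [hs]
    field_simp
    rw [sq, hsq]
    ring

theorem isometry_vertical_exp (t : ℝ) : Isometry fun s : ℝ => vertical t (Real.exp_pos s) :=
  isometry_vertical_line t

theorem tendsto_vertical_atBot (t : ℝ) :
    Tendsto (fun s : ℝ => planeToSphere (vertical t (Real.exp_pos s))) atBot
      (𝓝 (circleToSphere t)) := by
  refine tendsto_planeToSphere_coe.mpr ?_
  have h1 : Tendsto (fun s : ℝ => ((t : ℂ) + (Real.exp s : ℝ) * Complex.I)) atBot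
      (𝓝 ((t : ℂ) + (0 : ℝ) * Complex.I)) :=
    (((Complex.continuous_ofReal.tendsto _).comp Real.tendsto_exp_atBot).mul_const _).const_add _
  simp only [Complex.ofReal_zero, zero_mul, add_zero] at h1
  exact h1.congr fun s => (Complex.mk_eq_add_mul_I _ _).symm

theorem tendsto_vertical_atTop (t : ℝ) :
    Tendsto (fun s : ℝ => planeToSphere (vertical t (Real.exp_pos s))) atTop
      (𝓝 (circleToSphere OnePoint.infty)) := by
  refine tendsto_planeToSphere_infty.mpr ?_
  rw [← tendsto_norm_atTop_iff_cobounded]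
  refine tendsto_atTop_mono (fun s => ?_) Real.tendsto_exp_atTop
  exact (le_abs_self _).trans (Complex.abs_im_le_norm (⟨t, Real.exp s⟩ : ℂ))

theorem tendsto_planeToSphere_smul {ι : Type*} {l : Filter ι} {f : ι → ℍ} {ξ : OnePoint ℝ}
    (σ : SL(2, ℝ)) (hf : Tendsto (fun i => planeToSphere (f i)) l (𝓝 (circleToSphere ξ))) :
    Tendsto (fun i => planeToSphere (σ • f i)) l (𝓝 (circleToSphere (σ • ξ))) := by
  simp only [planeToSphere_smul, circleToSphere_smul]
  exact ((moebius_continuous _).tendsto _).comp hf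

/-- A repelling fixed point of an element of `SL(2, ℝ)` fixing `∞` and preserving `K` is an ideal
boundary point of `K`. -/
theorem mem_idealBoundary_of_affine {K : Set ℍ} (hK : K.Nonempty) {τ : SL(2, ℝ)}
    (hτK : ∀ z : ℍ, τ • z ∈ K → z ∈ K) {a b t : ℝ} (ha : 1 < a)
    (hτ : ∀ z : ℍ, ((τ • z : ℍ) : ℂ) = a * z + b) (ht : a * t + b = t) :
    (t : OnePoint ℝ) ∈ idealBoundary K := by
  obtain ⟨z, hz⟩ := hK
  have hinv : ∀ n : ℕ, (τ⁻¹ ^ n) • z ∈ K := by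
    intro n
    induction n with
    | zero => simpa
    | succ n ih => exact hτK _ (by rwa [pow_succ', mul_smul, smul_inv_smul])
  have ha0 : (a : ℂ) ≠ 0 := by exact_mod_cast (by linarith : a ≠ 0)
  have ht' : (a : ℂ) * t + b = t := by exact_mod_cast ht
  have hval : ∀ n : ℕ, (((τ⁻¹ ^ n) • z : ℍ) : ℂ) = t + (z - t) * ((a⁻¹ : ℝ) : ℂ) ^ n := by
    intro n
    induction n with
    | zero => simp
    | succ n ih =>
      have h1 := hτ ((τ⁻¹ ^ (n + 1)) • z)
      rw [pow_succ', mul_smul, smul_inv_smul, ih] at h1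
      rw [pow_succ', mul_smul]
      refine mul_left_cancel₀ ha0 ?_
      push_cast at h1 ⊢
      rw [pow_succ]
      have : (a : ℂ) * (t + (z - t) * ((a : ℂ)⁻¹ ^ n * (a : ℂ)⁻¹)) =
        a * t + (z - t) * (a : ℂ)⁻¹ ^ n := by field_simp
      rw [this]
      linear_combination -h1 - ht'
  refine mem_idealBoundary_of_tendsto (l := atTop) hinv (tendsto_planeToSphere_coe.mpr ?_)
  simp only [hval]
  have hpow : Tendsto (fun n : ℕ => ((a⁻¹ : ℝ) : ℂ) ^ n) atTop (𝓝 0) := by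
    refine tendsto_pow_atTop_nhds_zero_of_norm_lt_one ?_
    rw [Complex.norm_real, Real.norm_of_nonneg (by positivity)]
    exact inv_lt_one_of_one_lt₀ ha
  simpa using (hpow.const_mul ((z : ℂ) - t)).const_add (t : ℂ)

end Hyp

open Hyp

namespace HyperbolicMetric

variable {S : Type*} [TopologicalSpace S] (h : HyperbolicMetric S)

/-! ### The topology of the space of geodesics -/

instance : SecondCountableTopology h.IdealBoundary :=
  inferInstanceAs (SecondCountableTopology {ξ : OnePoint ℝ // ξ ∈ idealBoundary h.region})

instance : CompactSpace h.IdealBoundary :=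
  isCompact_iff_compactSpace.mp (isClosed_idealBoundary h.region).isCompact

theorem continuous_idealBoundary_val : Continuous fun ξ : h.IdealBoundary => ξ.1 :=
  continuous_subtype_val

theorem continuous_smul_idealBoundary (γ : h.deck) :
    Continuous fun ξ : h.IdealBoundary => γ • ξ :=
  ((Hyp.continuous_smul_circle γ).comp h.continuous_idealBoundary_val).subtype_mk _

theorem isQuotientMap_sym2 (X : Type*) [TopologicalSpace X] :
    IsQuotientMap fun p : X × X => s(p.1, p.2) :=
  isQuotientMap_quot_mk

theorem isOpenMap_sym2 (X : Type*) [TopologicalSpace X] :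
    IsOpenMap fun p : X × X => s(p.1, p.2) := by
  intro W hW
  rw [← (isQuotientMap_sym2 X).isOpen_preimage]
  have : (fun p : X × X => s(p.1, p.2)) ⁻¹' ((fun p : X × X => s(p.1, p.2)) '' W) =
      W ∪ Prod.swap ⁻¹' W := by
    ext ⟨p, q⟩
    constructor
    · rintro ⟨⟨p', q'⟩, hm, he⟩
      rcases Sym2.eq_iff.mp he with ⟨rfl, rfl⟩ | ⟨rfl, rfl⟩
      · exact Or.inl hm
      · exact Or.inr hm
    · rintro (hm | hm)
      · exact ⟨_, hm, rfl⟩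
      · exact ⟨_, hm, Sym2.eq_swap⟩
  rw [this]
  exact hW.union (hW.preimage continuous_swap)

instance : SecondCountableTopology h.Geodesics :=
  haveI : SecondCountableTopology (Sym2 h.IdealBoundary) :=
    (isQuotientMap_sym2 _).secondCountableTopology (isOpenMap_sym2 _)
  (IsInducing.subtypeVal (t := {g : Sym2 h.IdealBoundary | ¬ g.IsDiag})).secondCountableTopology

/-- The geodesics whose pair of end points, suitably ordered, lies in `W`. -/
def joining (W : Set (h.IdealBoundary × h.IdealBoundary)) : Set h.Geodesics :=
  {g | ∃ p ∈ W, g.1 = s(p.1, p.2)}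

theorem joining_eq_preimage (W : Set (h.IdealBoundary × h.IdealBoundary)) :
    h.joining W = (fun g : h.Geodesics => g.1) ⁻¹' ((fun p => s(p.1, p.2)) '' W) := by
  ext g
  simp only [joining, Set.mem_ofPred_eq, Set.mem_preimage, Set.mem_image, eq_comm]

theorem isOpen_joining {W : Set (h.IdealBoundary × h.IdealBoundary)} (hW : IsOpen W) :
    IsOpen (h.joining W) := by
  rw [joining_eq_preimage]
  exact (isOpenMap_sym2 _ W hW).preimage continuous_subtype_val

theorem isCompact_joining {W : Set (h.IdealBoundary × h.IdealBoundary)} (hW : IsCompact W)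
    (hne : ∀ p ∈ W, p.1 ≠ p.2) : IsCompact (h.joining W) := by
  rw [joining_eq_preimage]
  refine (IsInducing.subtypeVal.isCompact_preimage_iff ?_).mpr
    (hW.image (isQuotientMap_sym2 _).continuous)
  rintro _ ⟨p, hp, rfl⟩
  exact ⟨⟨s(p.1, p.2), fun hd => hne p hp (Sym2.mk_isDiag_iff.mp hd)⟩, rfl⟩

theorem continuous_smul_geodesics (γ : h.deck) : Continuous fun g : h.Geodesics => γ • g := by
  refine Continuous.subtype_mk ?_ _
  have hmap : Continuous (Sym2.map fun ξ : h.IdealBoundary => γ • ξ) := by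
    rw [(isQuotientMap_sym2 _).continuous_iff]
    have hc := h.continuous_smul_idealBoundary γ
    exact (isQuotientMap_sym2 _).continuous.comp (hc.prodMap hc)
  exact hmap.comp continuous_subtype_val

theorem smul_geodesic_val (γ : h.deck) {g : h.Geodesics} {u v : h.IdealBoundary}
    (hg : g.1 = s(u, v)) : (γ • g).1 = s(γ • u, γ • v) := by
  show Sym2.map (fun ξ => γ • ξ) g.1 = _
  rw [hg, Sym2.map_mk]

/-! ### Compactness of the surface and closed geodesics -/

/-- A compact set meets every deck orbit in the universal cover. -/
theorem exists_isCompact_forall_exists_deck [CompactSpace S] :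
    ∃ K : Set ℍ, IsCompact K ∧ ∀ p ∈ h.region, ∃ γ : h.deck, ∃ k ∈ K, (γ : SL(2, ℝ)) • k = p := by
  have hopen : ∀ n : ℕ, IsOpen (h.proj '' {z | dist (z : ℍ) I < n}) := fun n =>
    h.isCoveringMap_proj.isOpenMap _
      (isOpen_lt (continuous_subtype_val.dist continuous_const) continuous_const)
  have hmono : Monotone fun n : ℕ => h.proj '' {z | dist (z : ℍ) I < n} := fun m n hmn =>
    Set.image_mono fun z hz => lt_of_lt_of_le (show dist (z : ℍ) I < m from hz)
      (by exact_mod_cast hmn)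
  obtain ⟨n, hn⟩ := isCompact_univ.elim_directed_cover _ hopen (fun s _ => by
    obtain ⟨z, rfl⟩ := h.surjective_proj s
    obtain ⟨n, hn⟩ := exists_nat_gt (dist (z : ℍ) I)
    exact Set.mem_iUnion.mpr ⟨n, z, hn, rfl⟩) hmono.directed_le
  refine ⟨Metric.closedBall I n, isCompact_closedBall _ _, fun p hp => ?_⟩
  obtain ⟨k, hk, hkp⟩ := hn (Set.mem_univ (h.proj ⟨p, hp⟩))
  obtain ⟨γ, h1, h2, h3⟩ := h.exists_deck k ⟨p, hp⟩ hkp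
  exact ⟨⟨γ, h1, h2⟩, k, (show dist (k : ℍ) I < n from hk).le, h3⟩

/-- A geodesic invariant under a nontrivial translation by a deck transformation projects to a
closed geodesic. -/
theorem projectsToClosed_of_translation {x w : h.IdealBoundary} {σ : SL(2, ℝ)} {t : ℝ}
    (hx : σ • OnePoint.infty = x.1) (hw : σ • (t : OnePoint ℝ) = w.1) {γ : h.deck} {L : ℝ}
    (hL : 0 < L)
    (hγ : ∀ s : ℝ, (γ : SL(2, ℝ)) • σ • vertical t (Real.exp_pos s) =
      σ • vertical t (Real.exp_pos (s + L)))
    {g : h.Geodesics} (hg : g.1 = s(x, w)) : h.ProjectsToClosed g := by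
  have hmem : ∀ s : ℝ, σ • vertical t (Real.exp_pos s) ∈ h.region := fun s =>
    vertical_mem_of_mem_idealBoundary (h.isClosed_region.preimage (continuous_smul_plane σ))
      (h.convex_region.preimage_smul σ) (smul_mem_idealBoundary_iff.mp (hx ▸ x.2))
      (smul_mem_idealBoundary_iff.mp (hw ▸ w.2)) (Real.exp_pos s)
  refine ⟨fun s => ⟨σ • vertical t (Real.exp_pos s), hmem s⟩, ⟨?_, w, x, ?_, ?_, ?_⟩, L, hL, ?_⟩
  · exact Isometry.of_dist_eq fun s s' =>
      (dist_smul σ _ _).trans ((isometry_vertical_exp t).dist_eq s s')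
  · rw [hg, Sym2.eq_swap]
  · rw [← hw]
    exact tendsto_planeToSphere_smul σ (tendsto_vertical_atBot t)
  · rw [← hx]
    exact tendsto_planeToSphere_smul σ (tendsto_vertical_atTop t)
  · intro s
    exact (γ.2.2 ⟨_, hmem s⟩ ⟨_, hmem (s + L)⟩ (hγ s)).symm

/-- If `x`, `x'` lie on the arc opposite to `(y₁, y₂)`, `y'` lies in `(y₁, y₂)` and `{x', y'}` crosses
neither `{x, y₁}` nor `{x, y₂}`, then `x' = x`. -/
theorem eq_of_not_cross {x x' y' y₁ y₂ : h.IdealBoundary} {g : h.Geodesics}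
    (hy' : Prec y₁.1 y'.1 y₂.1) (hx : Prec y₂.1 x.1 y₁.1) (hx' : Prec y₂.1 x'.1 y₁.1)
    (hg : g.1 = s(x', y')) (hcross : ∀ η ∈ h.fan x {y₁, y₂}, ¬ h.CrossInSurface g η)
    (hne₁ : x ≠ y₁) (hne₂ : x ≠ y₂) : x' = x := by
  by_contra hne
  have hmem : ∀ y ∈ ({y₁, y₂} : Set h.IdealBoundary), (hxy : x ≠ y) →
      ¬ h.IntersectTransversely g ⟨s(x, y), fun hd => hxy (Sym2.mk_isDiag_iff.mp hd)⟩ :=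
    fun y hy hxy hint => hcross _ ⟨y, hy, rfl⟩ ⟨1, by rwa [one_smul]⟩
  rcases linked_of_prec hy' hx hx' (fun he => hne (Subtype.ext he)) with ⟨h1, h2⟩ | ⟨h1, h2⟩
  · exact hmem y₁ (by simp) hne₁ ⟨x', y', y₁, x, hg, Sym2.eq_swap, h1, h2⟩
  · exact hmem y₂ (by simp) hne₂ ⟨y', x', y₂, x, by rw [hg, Sym2.eq_swap], Sym2.eq_swap, h1, h2⟩

/-- Let `γ n` be deck transformations moving a compact set along a geodesic ray towards `x`. If
infinitely many `γ n` send one geodesic into a small fan at `x`, then some geodesic from `x` into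
the arc `(y₁, y₂)` projects to a closed geodesic. -/
theorem exists_projectsToClosed {x y₁ y₂ : h.IdealBoundary} {σ : SL(2, ℝ)}
    (hσ : σ • OnePoint.infty = x.1) (hxy : ¬ Prec y₁.1 x.1 y₂.1) {t₀ : ℝ} {K : Set ℍ}
    (hK : IsBounded K) {γ : ℕ → h.deck} {k : ℕ → ℍ} (hk : ∀ n, k n ∈ K)
    (hkr : ∀ n, k n ∈ h.region)
    (hγ : ∀ n, (γ n : SL(2, ℝ)) • k n = σ • vertical t₀ (Nat.cast_add_one_pos (α := ℝ) n))
    {u v : h.IdealBoundary}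
    (hfreq : ∃ᶠ n in atTop, γ n • u = x ∧ Prec y₁.1 (γ n • v).1 y₂.1 ∧
      ∃ s ∈ Set.Ioo (t₀ - 1) (t₀ + 1), σ • (s : OnePoint ℝ) = (γ n • v).1) :
    ∃ w : h.IdealBoundary, Prec y₁.1 w.1 y₂.1 ∧
      ∀ g : h.Geodesics, g.1 = s(x, w) → h.ProjectsToClosed g := by
  obtain ⟨n₀, hu₀, hv₀, s₀, hs₀, hσs₀⟩ := hfreq.exists
  have hcont : Continuous fun s : ℝ => σ • (s : OnePoint ℝ) :=
    (continuous_smul_circle σ).comp OnePoint.continuous_coe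
  obtain ⟨ε, hε, hball⟩ := Metric.isOpen_iff.mp
    ((isOpen_setOf_prec y₁.1 y₂.1).preimage hcont) s₀
    (show Prec y₁.1 (σ • (s₀ : OnePoint ℝ)) y₂.1 from hσs₀ ▸ hv₀)
  obtain ⟨D, hD⟩ := Metric.isBounded_iff.mp hK
  obtain ⟨N, hN⟩ := exists_nat_gt ((1 + 2 / ε) * (((n₀ : ℝ) + 1) * Real.exp D))
  obtain ⟨n, ⟨hun, hvn, s, hs, hσs⟩, hnN⟩ :=
    (hfreq.and_eventually (eventually_ge_atTop N)).exists
  set ρ : h.deck := γ n * (γ n₀)⁻¹ with hρ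
  set τ : SL(2, ℝ) := σ⁻¹ * (ρ : SL(2, ℝ)) * σ with hτ
  have hστ : ∀ z : ℍ, σ • τ • z = (ρ : SL(2, ℝ)) • σ • z := fun z => by
    rw [hτ, mul_smul, mul_smul, smul_inv_smul]
  have hστ' : ∀ ξ : OnePoint ℝ, τ • ξ = σ⁻¹ • (ρ : SL(2, ℝ)) • σ • ξ := fun ξ => by
    rw [hτ, mul_smul, mul_smul]
  have hρx : (ρ : SL(2, ℝ)) • x.1 = x.1 := by
    have : ρ • x = x := by rw [hρ, mul_smul]; nth_rewrite 1 [← hu₀]; rw [inv_smul_smul, hun]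
    exact congrArg Subtype.val this
  have hρv : (ρ : SL(2, ℝ)) • (γ n₀ • v).1 = (γ n • v).1 := by
    have : ρ • (γ n₀ • v) = γ n • v := by rw [hρ, mul_smul, inv_smul_smul]
    exact congrArg Subtype.val this
  have hτinf : τ • (OnePoint.infty : OnePoint ℝ) = OnePoint.infty := by
    rw [hστ', hσ, hρx, ← hσ, inv_smul_smul]
  obtain ⟨a, b, ha, hτz, hτs⟩ := exists_affine_of_smul_infty hτinf
  have hab : a * s₀ + b = s := by
    have h1 : τ • (s₀ : OnePoint ℝ) = (s : OnePoint ℝ) := by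
      rw [hστ', hσs₀, hρv, ← hσs, inv_smul_smul]
    rw [hτs] at h1
    exact OnePoint.coe_injective h1
  have hlarge : 1 + 2 / ε < a := by
    have him : (τ • vertical t₀ (Nat.cast_add_one_pos (α := ℝ) n₀)).im = a * ((n₀ : ℝ) + 1) := by
      rw [← coe_im, hτz]; simp
    have hdist : dist (vertical t₀ (Nat.cast_add_one_pos (α := ℝ) n))
        (τ • vertical t₀ (Nat.cast_add_one_pos (α := ℝ) n₀)) ≤ D := by
      rw [← dist_smul σ, hστ, ← hγ, ← hγ, hρ, Subgroup.coe_mul, mul_smul, Subgroup.coe_inv,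
        inv_smul_smul, dist_smul]
      exact hD (hk n) (hk n₀)
    have h1 := im_le_im_mul_exp_dist (vertical t₀ (Nat.cast_add_one_pos (α := ℝ) n))
      (τ • vertical t₀ (Nat.cast_add_one_pos (α := ℝ) n₀))
    rw [him] at h1
    have h2 : (n : ℝ) + 1 ≤ a * (((n₀ : ℝ) + 1) * Real.exp D) := by
      refine le_trans h1 ?_
      rw [← mul_assoc]
      gcongr
    have h3 : (N : ℝ) ≤ n := by exact_mod_cast hnN
    have h4 : 0 < ((n₀ : ℝ) + 1) * Real.exp D := by positivity
    exact lt_of_mul_lt_mul_right (by linarith) h4.le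
  have hε2 : 0 < 2 / ε := by positivity
  have ha1 : 1 < a := by linarith
  set t : ℝ := b / (1 - a) with ht
  have hfix : a * t + b = t := by
    have : 1 - a ≠ 0 := by linarith
    rw [ht]; field_simp; ring
  have htball : t ∈ Metric.ball s₀ ε := by
    have h1 : (a - 1) * (t - s₀) = s₀ - s := by linear_combination hfix - hab
    have h2 : (a - 1) * |t - s₀| < 2 := by
      rw [← abs_of_pos (show 0 < a - 1 by linarith), ← abs_mul, h1, abs_lt]
      constructor <;> linarith [hs.1, hs.2, hs₀.1, hs₀.2]
    have h3 : 2 < (a - 1) * ε := by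
      have : 2 / ε < a - 1 := by linarith
      rwa [div_lt_iff₀ hε] at this
    rw [Metric.mem_ball, Real.dist_eq]
    exact lt_of_mul_lt_mul_left (h2.trans h3) (by linarith)
  have htmem : σ • (t : OnePoint ℝ) ∈ idealBoundary h.region := by
    refine smul_mem_idealBoundary_iff.mpr (mem_idealBoundary_of_affine ?_ ?_ ha1 hτz hfix)
    · exact ⟨σ⁻¹ • k n, by simpa using hkr n⟩
    · intro z hz
      have : (ρ : SL(2, ℝ)) • σ • z ∈ h.region := by rw [← hστ]; exact hz
      exact (ρ.2.1 _).mp this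
  refine ⟨⟨σ • (t : OnePoint ℝ), htmem⟩, hball htball, fun g hg => ?_⟩
  refine h.projectsToClosed_of_translation (γ := ρ) hσ rfl (Real.log_pos ha1) (fun r => ?_) hg
  rw [← hστ]
  congr 1
  apply UpperHalfPlane.ext
  rw [hτz]
  apply Complex.ext
  · simpa using hfix
  · simp [Real.exp_add, Real.exp_log ha, mul_comm]

/-- Geodesics that are carried by a deck transformation to a geodesic from `x` to a point over
`[t₀ - 1, t₀ + 1]`, taking a point of the compact set to `t₀ + i T`, stay in a compact set. -/
theorem inv_le_norm_cayley_sub_of_deck {x u v : h.IdealBoundary} {σ : SL(2, ℝ)}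
    (hσ : σ • OnePoint.infty = x.1) {t₀ T s M : ℝ} (hT : 0 < T) (hs : |s - t₀| ≤ T) {k : ℍ}
    (hM : (1 + Complex.normSq (k : ℂ)) / k.im ≤ M) {γ : h.deck}
    (hγ : (γ : SL(2, ℝ)) • k = σ • vertical t₀ hT) (hu : γ • u = x)
    (hv : σ • (s : OnePoint ℝ) = (γ • v).1) : 1 / M ≤ ‖cayley u.1 - cayley v.1‖ := by
  obtain ⟨τ, h1, h2, h3⟩ := exists_smul_I_eq_vertical t₀ hT
  set ζ : SL(2, ℝ) := (γ : SL(2, ℝ))⁻¹ * σ * τ with hζ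
  have hI : ζ • I = k := by rw [hζ, mul_smul, mul_smul, h2, ← hγ, inv_smul_smul]
  have hinf : ζ • OnePoint.infty = u.1 := by
    rw [hζ, mul_smul, mul_smul, h1, hσ, ← hu]
    exact inv_smul_smul (γ : SL(2, ℝ)) u.1
  have hv' : ζ • (((s - t₀) / T : ℝ) : OnePoint ℝ) = v.1 := by
    rw [hζ, mul_smul, mul_smul, h3, mul_div_cancel₀ _ hT.ne', sub_add_cancel, hv]
    exact inv_smul_smul (γ : SL(2, ℝ)) v.1
  rw [← hinf, ← hv']
  refine inv_le_norm_cayley_sub ?_ (by rwa [hI])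
  rw [abs_div, abs_of_pos hT, div_le_one hT]
  exact hs

end HyperbolicMetric

theorem mainTheorem3 {S : Type*} [TopologicalSpace S] [T2Space S] [CompactSpace S]
    [ConnectedSpace S] (h : HyperbolicMetric S)
    (x y₁ y₂ : h.IdealBoundary)
    (hx : x ∉ h.closedInterval y₁ y₂)
    (hclosed : ∀ g ∈ h.fan x (h.closedInterval y₁ y₂), ¬ h.ProjectsToClosed g)
    (c : Measure h.Geodesics) (hc : h.IsCurrent c)
    (hcross : ∀ g ∈ c.support, ∀ η ∈ h.fan x {y₁, y₂}, ¬ h.CrossInSurface g η) :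
    Disjoint (h.fan x (h.openInterval y₁ y₂)) c.support := by
  rw [Set.disjoint_left]
  rintro g₀ ⟨y, ⟨hy, hy'⟩, hg₀⟩ hsupp
  simp only [Set.mem_insert_iff, Set.mem_singleton_iff, not_or] at hy'
  have hyp : Prec y₁.1 y.1 y₂.1 := (hy.resolve_left hy'.1).resolve_left hy'.2
  have hx₁ : x ≠ y₁ := fun he => hx (Or.inl he)
  have hx₂ : x ≠ y₂ := fun he => hx (Or.inr (Or.inl he))
  have hxn : ¬ Prec y₁.1 x.1 y₂.1 := fun he => hx (Or.inr (Or.inr he))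
  have hxp : Prec y₂.1 x.1 y₁.1 := prec_of_not_prec hyp (fun he => hx₁ (Subtype.ext he))
    (fun he => hx₂ (Subtype.ext he)) hxn
  have hyx : y.1 ≠ x.1 := fun he => hxn (he ▸ hyp)
  obtain ⟨σ, hσ⟩ := exists_smul_infty_eq x.1
  obtain ⟨t₀, ht₀⟩ : ∃ t₀ : ℝ, σ • (t₀ : OnePoint ℝ) = y.1 := by
    obtain ⟨t₀, ht₀⟩ := OnePoint.ne_infty_iff_exists.mp
      (show σ⁻¹ • y.1 ≠ OnePoint.infty from fun he => hyx (by rw [← hσ, ← he, smul_inv_smul]))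
    exact ⟨t₀, by rw [ht₀, smul_inv_smul]⟩
  -- the part of the support near `{x, y}`
  set Nx : Set h.IdealBoundary := {z | Prec y₂.1 z.1 y₁.1} with hNx
  set Ny : Set h.IdealBoundary := {z | Prec y₁.1 z.1 y₂.1 ∧
    ∃ s ∈ Set.Ioo (t₀ - 1) (t₀ + 1), σ • (s : OnePoint ℝ) = z.1} with hNy
  have hNxo : IsOpen Nx := (isOpen_setOf_prec _ _).preimage h.continuous_idealBoundary_val
  have hNyo : IsOpen Ny := by
    refine IsOpen.and ((isOpen_setOf_prec _ _).preimage h.continuous_idealBoundary_val) ?_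
    have : {z : h.IdealBoundary | ∃ s ∈ Set.Ioo (t₀ - 1) (t₀ + 1), σ • (s : OnePoint ℝ) = z.1} =
        (fun z : h.IdealBoundary => σ⁻¹ • z.1) ⁻¹' ((↑) '' Set.Ioo (t₀ - 1) (t₀ + 1)) := by
      ext z
      simp only [Set.mem_ofPred_eq, Set.mem_preimage, Set.mem_image, eq_inv_smul_iff]
    rw [this]
    exact (OnePoint.isOpenEmbedding_coe.isOpenMap _ isOpen_Ioo).preimage
      ((continuous_smul_circle σ⁻¹).comp h.continuous_idealBoundary_val)
  set V := h.joining (Nx ×ˢ Ny) with hV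
  have hVo : IsOpen V := h.isOpen_joining (hNxo.prod hNyo)
  have hgV : g₀ ∈ V := ⟨(x, y), ⟨hxp, hyp, t₀, by simp, ht₀⟩, hg₀⟩
  set A := V ∩ c.support with hA
  have hAm : MeasurableSet A := hVo.measurableSet.inter Measure.isClosed_support.measurableSet
  have hApos : c A ≠ 0 := by
    rw [hA, measure_inter_conull Measure.measure_compl_support]
    exact ((Measure.mem_support_iff_forall g₀).mp hsupp V (hVo.mem_nhds hgV)).ne'
  have hAfan : ∀ g ∈ A, ∃ v ∈ Ny, g.1 = s(x, v) := by
    rintro g ⟨⟨⟨x', v⟩, ⟨hx', hv⟩, hg⟩, hgs⟩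
    refine ⟨v, hv, ?_⟩
    rw [hg, h.eq_of_not_cross hv.1 hxp hx' hg (hcross g hgs) hx₁ hx₂]
  -- deck transformations along the ray towards `x`
  obtain ⟨K, hK, hKdeck⟩ := h.exists_isCompact_forall_exists_deck
  have hray : ∀ n : ℕ, σ • vertical t₀ (Nat.cast_add_one_pos (α := ℝ) n) ∈ h.region := fun n =>
    vertical_mem_of_mem_idealBoundary (h.isClosed_region.preimage (continuous_smul_plane σ))
      (h.convex_region.preimage_smul σ) (smul_mem_idealBoundary_iff.mp (hσ ▸ x.2))
      (smul_mem_idealBoundary_iff.mp (ht₀ ▸ y.2)) _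
  choose γ k hkK hγk using fun n => hKdeck _ (hray n)
  have hkr : ∀ n, k n ∈ h.region := fun n => ((γ n).2.1 _).mp (by rw [hγk]; exact hray n)
  obtain ⟨M, hM⟩ : ∃ M : ℝ, ∀ z ∈ K, (1 + Complex.normSq (z : ℂ)) / z.im ≤ M := by
    have hcont : Continuous fun z : ℍ => (1 + Complex.normSq (z : ℂ)) / z.im :=
      (continuous_const.add (Complex.continuous_normSq.comp continuous_coe)).div continuous_im
        fun z => z.im_ne_zero
    obtain ⟨M, hM⟩ := (hK.image hcont).bddAbove
    exact ⟨M, fun z hz => hM ⟨z, hz, rfl⟩⟩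
  have hM0 : 0 < M := lt_of_lt_of_le
    (div_pos (by linarith [Complex.normSq_nonneg (k 0 : ℂ)]) (k 0).im_pos) (hM _ (hkK 0))
  set F := h.joining {p | 1 / M ≤ ‖cayley p.1.1 - cayley p.2.1‖} with hF
  have hFc : IsCompact F := by
    have hcc := continuous_cayley.comp h.continuous_idealBoundary_val
    refine h.isCompact_joining (IsClosed.isCompact (isClosed_le continuous_const
      ((hcc.comp continuous_fst).sub (hcc.comp continuous_snd)).norm)) ?_
    intro p hp he
    simp only [Set.mem_ofPred_eq, he, sub_self, norm_zero] at hp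
    exact absurd hp (not_le.mpr (by positivity))
  have := hc.locallyFinite
  have hsplit : ∀ (n : ℕ) (g : h.Geodesics) (u v : h.IdealBoundary), g.1 = s(u, v) → γ n • g ∈ A →
      (γ n • u = x ∧ γ n • v ∈ Ny) ∨ (γ n • v = x ∧ γ n • u ∈ Ny) := by
    intro n g u v hg hgA
    obtain ⟨w, hw, he⟩ := hAfan _ hgA
    rw [h.smul_geodesic_val _ hg] at he
    rcases Sym2.eq_iff.mp he with ⟨h1, h2⟩ | ⟨h1, h2⟩
    · exact Or.inl ⟨h1, h2 ▸ hw⟩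
    · exact Or.inr ⟨h2, h1 ▸ hw⟩
  have hBF : ∀ n, (fun g => γ n • g) ⁻¹' A ⊆ F := by
    intro n g hgA
    obtain ⟨⟨u, v⟩, hg⟩ := Sym2.mk_surjective g.1
    have hkey : ∀ u v : h.IdealBoundary, γ n • u = x → γ n • v ∈ Ny →
        1 / M ≤ ‖cayley u.1 - cayley v.1‖ := by
      rintro u v hu ⟨-, s, hs, hσs⟩
      refine h.inv_le_norm_cayley_sub_of_deck hσ _ ?_ (hM _ (hkK n)) (hγk n) hu hσs
      rw [abs_le]
      have : (0 : ℝ) ≤ n := n.cast_nonneg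
      constructor <;> linarith [hs.1, hs.2]
    rcases hsplit n g u v hg.symm hgA with ⟨h1, h2⟩ | ⟨h1, h2⟩
    · exact ⟨(u, v), hkey u v h1 h2, hg.symm⟩
    · exact ⟨(v, u), hkey v u h1 h2, hg.symm.trans Sym2.eq_swap⟩
  obtain ⟨g, hg⟩ := exists_frequently_mem_of_le_measure hFc.measure_lt_top.ne
    (fun n => (h.continuous_smul_geodesics (γ n)).measurable hAm) hBF hApos
    fun n => (hc.invariant (γ n) A hAm).ge
  obtain ⟨u, v, hfreq⟩ : ∃ u v : h.IdealBoundary, ∃ᶠ n in atTop, γ n • u = x ∧ γ n • v ∈ Ny := by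
    obtain ⟨⟨u, v⟩, huv⟩ := Sym2.mk_surjective g.1
    rcases frequently_or_distrib.mp (hg.mono fun n hn => hsplit n g u v huv.symm hn) with h1 | h1
    · exact ⟨u, v, h1⟩
    · exact ⟨v, u, h1⟩
  obtain ⟨w, hw, hwc⟩ := h.exists_projectsToClosed hσ hxn hK.isBounded hkK hkr hγk hfreq
  have hxw : x ≠ w := fun he => hxn (he ▸ hw)
  exact hclosed ⟨s(x, w), fun hd => hxw (Sym2.mk_isDiag_iff.mp hd)⟩
    ⟨w, Or.inr (Or.inr hw), rfl⟩ (hwc _ rfl)
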